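/- Let $\mathbb{K}$ be a field, $d\ge 0$ an integer, and $\mathcal{A}$ a $\mathbb{K}$-algebra isomorphic to the algebra $\mathrm{Mat}_{d+1}(\mathbb{K})$ of $(d+1)\times(d+1)$ matrices over $\mathbb{K}$; for $X\in\mathcal{A}$ let $\mathrm{tr}(X)$ be the trace of the matrix corresponding to $X$ (it does not depend on the choice of isomorphism). Let $\Phi=(A;\{E_i\}_{i=0}^d;A^*;\{E^*_i\}_{i=0}^d)$ be a Leonard system in $\mathcal{A}$. That is: $A$ and $A^*$ are elements of $\mathcal{A}$, each having $d+1$ mutually distinct eigenvalues in $\mathbb{K}$; for suitable orderings $\theta_0,\dots,\theta_d$ and $\theta^*_0,\dots,\theta^*_d$ of the eigenvalues of $A$ and $A^*$, $$E_i=\prod_{j\ne i}\frac{A-\theta_jI}{\theta_i-\theta_j},\qquad E^*_i=\prod_{j\ne i}\frac{A^*-\theta^*_jI}{\theta^*_i-\theta^*_j}\qquad(0\le i\le d);$$ and for $0\le i,j\le d$ both $E_iA^*E_j$ and $E^*_iAE^*_j$ are zero if $|i-j|>1$ and nonzero if $|i-j|=1$. Let $V$ be a simple $\mathcal{A}$-module.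 Let $\varphi_1,\dots,\varphi_d$ be the first split sequence of $\Phi$, i.e. the nonzero scalars in $\mathbb{K}$ for which $V$ has a basis $u_0,\dots,u_d$ with $Au_i=\theta_iu_i+u_{i+1}$ $(0\le i\le d-1)$, $Au_d=\theta_du_d$, $A^*u_i=\varphi_iu_{i-1}+\theta^*_iu_i$ $(1\le i\le d)$, $A^*u_0=\theta^*_0u_0$. Let $\phi_1,\dots,\phi_d$ be the second split sequence of $\Phi$, i.e. the first split sequence of the Leonard system $(A;\{E_{d-i}\}_{i=0}^d;A^*;\{E^*_i\}_{i=0}^d)$. For $0\le i\le d$ define the polynomials $$\tau_i=\prod_{h=0}^{i-1}(\lambda-\theta_h),\quad \eta_i=\prod_{h=0}^{i-1}(\lambda-\theta_{d-h}),\quad \tau^*_i=\prod_{h=0}^{i-1}(\lambda-\theta^*_h),\quad \eta^*_i=\prod_{h=0}^{i-1}(\lambda-\theta^*_{d-h}).$$ Then for $0\le i\le d$ (empty products being $1$): $$\mathrm{tr}(\tau_i(A)E^*_0)=\frac{\varphi_1\varphi_2\cdots\varphi_i}{(\theta^*_0-\theta^*_1)(\theta^*_0-\theta^*_2)\cdots(\theta^*_0-\theta^*_i)},\qquad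 \mathrm{tr}(\tau_i(A)E^*_d)=\frac{\phi_d\phi_{d-1}\cdots\phi_{d-i+1}}{(\theta^*_d-\theta^*_{d-1})(\theta^*_d-\theta^*_{d-2})\cdots(\theta^*_d-\theta^*_{d-i})},$$ $$\mathrm{tr}(\eta_i(A)E^*_0)=\frac{\phi_1\phi_2\cdots\phi_i}{(\theta^*_0-\theta^*_1)(\theta^*_0-\theta^*_2)\cdots(\theta^*_0-\theta^*_i)},\qquad \mathrm{tr}(\eta_i(A)E^*_d)=\frac{\varphi_d\varphi_{d-1}\cdots\varphi_{d-i+1}}{(\theta^*_d-\theta^*_{d-1})(\theta^*_d-\theta^*_{d-2})\cdots(\theta^*_d-\theta^*_{d-i})},$$ $$\mathrm{tr}(\tau^*_i(A^*)E_0)=\frac{\varphi_1\varphi_2\cdots\varphi_i}{(\theta_0-\theta_1)(\theta_0-\theta_2)\cdots(\theta_0-\theta_i)},\qquad \mathrm{tr}(\tau^*_i(A^*)E_d)=\frac{\phi_1\phi_2\cdots\phi_i}{(\theta_d-\theta_{d-1})(\theta_d-\theta_{d-2})\cdots(\theta_d-\theta_{d-i})},$$ $$\mathrm{tr}(\eta^*_i(A^*)E_0)=\frac{\phi_d\phi_{d-1}\cdots\phi_{d-i+1}}{(\theta_0-\theta_1)(\theta_0-\theta_2)\cdots(\theta_0-\theta_i)},\qquad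 \mathrm{tr}(\eta^*_i(A^*)E_d)=\frac{\varphi_d\varphi_{d-1}\cdots\varphi_{d-i+1}}{(\theta_d-\theta_{d-1})(\theta_d-\theta_{d-2})\cdots(\theta_d-\theta_{d-i})}.$$ -/

import Mathlib

open Polynomial

/-- A Leonard system `Φ = (A; {E_i}; A*; {E*_i})`, `0 ≤ i ≤ d`, in a `K`-algebra `𝒜` (which is
isomorphic to `Mat_{d+1}(K)` wherever the notion is used).  The eigenvalue `θ_i` of `A` associated
with `E_i` and the eigenvalue `θ*_i` of `A*` associated with `E*_i` are recorded along with the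
idempotents; they are determined by `A E_i = θ_i E_i` and `A* E*_i = θ*_i E*_i`. -/
structure LeonardSystem (K : Type*) (𝒜 : Type*) (d : ℕ) [Field K] [Ring 𝒜] [Algebra K 𝒜] where
  /-- the element `A` -/
  A : 𝒜
  /-- the element `A*` (unrelated to any conjugate transpose) -/
  Astar : 𝒜
  /-- the primitive idempotents `E_0, …, E_d` of `A` -/
  E : Fin (d + 1) → 𝒜
  /-- the primitive idempotents `E*_0, …, E*_d` of `A*` -/
  Estar : Fin (d + 1) → 𝒜
  /-- the eigenvalue sequence `θ_0, …, θ_d` -/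
  θ : Fin (d + 1) → K
  /-- the dual eigenvalue sequence `θ*_0, …, θ*_d` -/
  θstar : Fin (d + 1) → K
  /-- `A` is multiplicity-free: the `d + 1` scalars `θ_i` are mutually distinct eigenvalues. -/
  θ_injective : Function.Injective θ
  θ_mem_spectrum : ∀ i, θ i ∈ spectrum K A
  /-- `A*` is multiplicity-free: the `d + 1` scalars `θ*_i` are mutually distinct eigenvalues. -/
  θstar_injective : Function.Injective θstar
  θstar_mem_spectrum : ∀ i, θstar i ∈ spectrum K Astar
  /-- `E_i = ∏_{j ≠ i} (A - θ_j I) / (θ_i - θ_j)` -/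
  E_eq : ∀ i, E i =
    aeval A (∏ j ∈ Finset.univ.erase i, C (θ i - θ j)⁻¹ * (X - C (θ j)))
  /-- `E*_i = ∏_{j ≠ i} (A* - θ*_j I) / (θ*_i - θ*_j)` -/
  Estar_eq : ∀ i, Estar i =
    aeval Astar (∏ j ∈ Finset.univ.erase i, C (θstar i - θstar j)⁻¹ * (X - C (θstar j)))
  E_mul_Astar_mul_E_eq_zero :
    ∀ i j : Fin (d + 1), 1 < |(i : ℤ) - (j : ℤ)| → E i * Astar * E j = 0
  E_mul_Astar_mul_E_ne_zero :
    ∀ i j : Fin (d + 1), |(i : ℤ) - (j : ℤ)| = 1 → E i * Astar * E j ≠ 0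
  Estar_mul_A_mul_Estar_eq_zero :
    ∀ i j : Fin (d + 1), 1 < |(i : ℤ) - (j : ℤ)| → Estar i * A * Estar j = 0
  Estar_mul_A_mul_Estar_ne_zero :
    ∀ i j : Fin (d + 1), |(i : ℤ) - (j : ℤ)| = 1 → Estar i * A * Estar j ≠ 0

namespace LeonardSystem

theorem abs_rev_sub_rev {d : ℕ} (i j : Fin (d + 1)) :
    |((Fin.rev i : Fin (d + 1)) : ℤ) - ((Fin.rev j : Fin (d + 1)) : ℤ)| = |(i : ℤ) - (j : ℤ)| := by
  rw [abs_sub_comm (i : ℤ)]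
  congr 1
  have hi := i.isLt
  have hj := j.isLt
  simp only [Fin.val_rev]
  omega

theorem prod_erase_rev {M : Type*} [CommMonoid M] {d : ℕ} (f : Fin (d + 1) → M)
    (i : Fin (d + 1)) :
    ∏ j ∈ Finset.univ.erase i, f (Fin.rev j) = ∏ j ∈ Finset.univ.erase (Fin.rev i), f j := by
  refine Finset.prod_bij' (fun j _ => Fin.rev j) (fun j _ => Fin.rev j) ?_ ?_ ?_ ?_ ?_
  · intro j hj
    simpa using hj
  · intro j hj
    simp only [Finset.mem_erase, Finset.mem_univ, and_true] at hj ⊢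
    exact fun h => hj (by rw [← h, Fin.rev_rev])
  · simp
  · simp
  · simp

variable {K 𝒜 : Type*} {d : ℕ} [Field K] [Ring 𝒜] [Algebra K 𝒜]

/-- The relative `Φ^⇓ = (A; {E_{d-i}}; A*; {E*_i})` of `Φ`. -/
def ddown (Φ : LeonardSystem K 𝒜 d) : LeonardSystem K 𝒜 d where
  A := Φ.A
  Astar := Φ.Astar
  E := fun i => Φ.E (Fin.rev i)
  Estar := Φ.Estar
  θ := fun i => Φ.θ (Fin.rev i)
  θstar := Φ.θstar
  θ_injective := fun _ _ h => Fin.rev_injective (Φ.θ_injective h)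
  θ_mem_spectrum := fun i => Φ.θ_mem_spectrum (Fin.rev i)
  θstar_injective := Φ.θstar_injective
  θstar_mem_spectrum := Φ.θstar_mem_spectrum
  E_eq := fun i => by
    rw [Φ.E_eq, ← prod_erase_rev]
  Estar_eq := Φ.Estar_eq
  E_mul_Astar_mul_E_eq_zero := fun i j h =>
    Φ.E_mul_Astar_mul_E_eq_zero _ _ (by rwa [abs_rev_sub_rev])
  E_mul_Astar_mul_E_ne_zero := fun i j h =>
    Φ.E_mul_Astar_mul_E_ne_zero _ _ (by rwa [abs_rev_sub_rev])
  Estar_mul_A_mul_Estar_eq_zero := Φ.Estar_mul_A_mul_Estar_eq_zero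
  Estar_mul_A_mul_Estar_ne_zero := Φ.Estar_mul_A_mul_Estar_ne_zero

/-- `φ_1, …, φ_d` is the first split sequence of `Φ`: there is a `Φ`-split basis `u_0, …, u_d` of
the simple `𝒜`-module `V` with these (nonzero) scalars.  The scalar `φ_{i+1}` of the mathematical
text is `φ i` with `i : Fin d`. -/
def IsFirstSplitSequence (Φ : LeonardSystem K 𝒜 d) (V : Type*) [AddCommGroup V] [Module K V]
    [Module 𝒜 V] (φ : Fin d → K) : Prop :=
  (∀ i, φ i ≠ 0) ∧
  ∃ u : Module.Basis (Fin (d + 1)) K V,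
    (∀ i : Fin d, Φ.A • u i.castSucc = Φ.θ i.castSucc • u i.castSucc + u i.succ) ∧
    Φ.A • u (Fin.last d) = Φ.θ (Fin.last d) • u (Fin.last d) ∧
    (∀ i : Fin d, Φ.Astar • u i.succ = φ i • u i.castSucc + Φ.θstar i.succ • u i.succ) ∧
    Φ.Astar • u 0 = Φ.θstar 0 • u 0

/-- `ϕ_1, …, ϕ_d` is the second split sequence of `Φ`, i.e. the first split sequence of `Φ^⇓`. -/
def IsSecondSplitSequence (Φ : LeonardSystem K 𝒜 d) (V : Type*) [AddCommGroup V] [Module K V]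
    [Module 𝒜 V] (ϕ : Fin d → K) : Prop :=
  Φ.ddown.IsFirstSplitSequence V ϕ

/-- `τ_i = (λ - θ_0)(λ - θ_1) ⋯ (λ - θ_{i-1})` -/
noncomputable def τ (Φ : LeonardSystem K 𝒜 d) (i : Fin (d + 1)) : K[X] :=
  ∏ j ∈ Finset.Iio i, (X - C (Φ.θ j))

/-- `η_i = (λ - θ_d)(λ - θ_{d-1}) ⋯ (λ - θ_{d-i+1})` -/
noncomputable def η (Φ : LeonardSystem K 𝒜 d) (i : Fin (d + 1)) : K[X] :=
  ∏ j ∈ Finset.Iio i, (X - C (Φ.θ (Fin.rev j)))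

/-- `τ*_i = (λ - θ*_0)(λ - θ*_1) ⋯ (λ - θ*_{i-1})` -/
noncomputable def τstar (Φ : LeonardSystem K 𝒜 d) (i : Fin (d + 1)) : K[X] :=
  ∏ j ∈ Finset.Iio i, (X - C (Φ.θstar j))

/-- `η*_i = (λ - θ*_d)(λ - θ*_{d-1}) ⋯ (λ - θ*_{d-i+1})` -/
noncomputable def ηstar (Φ : LeonardSystem K 𝒜 d) (i : Fin (d + 1)) : K[X] :=
  ∏ j ∈ Finset.Iio i, (X - C (Φ.θstar (Fin.rev j)))

end LeonardSystem

/-- For a sequence `x_1, …, x_d` (with `x_{j+1}` stored as `x j`), the product `x_1 x_2 ⋯ x_i`. -/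
def initialProd {K : Type*} [Field K] {d : ℕ} (x : Fin d → K) (i : Fin (d + 1)) : K :=
  ∏ j : Fin d with j.castSucc < i, x j

/-- For a sequence `x_1, …, x_d` (with `x_{j+1}` stored as `x j`), the product
`x_d x_{d-1} ⋯ x_{d-i+1}`. -/
def finalProd {K : Type*} [Field K] {d : ℕ} (x : Fin d → K) (i : Fin (d + 1)) : K :=
  ∏ j : Fin d with j.castSucc < i, x (Fin.rev j)

/-- For a sequence `t_0, …, t_d`, the product `(t_0 - t_1)(t_0 - t_2) ⋯ (t_0 - t_i)`. -/
def initialDiffProd {K : Type*} [Field K] {d : ℕ} (t : Fin (d + 1) → K) (i : Fin (d + 1)) : K :=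
  ∏ j ∈ Finset.Ioc 0 i, (t 0 - t j)

/-- For a sequence `t_0, …, t_d`, the product
`(t_d - t_{d-1})(t_d - t_{d-2}) ⋯ (t_d - t_{d-i})`. -/
def finalDiffProd {K : Type*} [Field K] {d : ℕ} (t : Fin (d + 1) → K) (i : Fin (d + 1)) : K :=
  ∏ j ∈ Finset.Ioc 0 i, (t (Fin.last d) - t (Fin.rev j))

/-!
Only the split basis matters. Call `R`, `S` a bidiagonal pair on a basis `u_0, …, u_d` if
`R u_i = a_i u_i + α_{i+1} u_{i+1}` and `S u_i = b_i u_i + β_i u_{i-1}`. If the `b_i` are distinct,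
let `P` be the primitive idempotent of `S` for `b_0`. Since `P S = b_0 P`, applying `P` to the
formula for `S u_i` gives `(b_0 - b_i) P u_i = β_i P u_{i-1}`, whence `P u_i` is
`β_1 ⋯ β_i / ((b_0 - b_1) ⋯ (b_0 - b_i))` times `u_0`. On the other hand
`(R - a_0) ⋯ (R - a_{i-1}) u_0 = α_1 ⋯ α_i u_i`. So the product of these two operators has rank at
most one, and its trace can be read off
(`IsBidiagonalPair.trace_aeval_prod_mul_aeval_basis`).

Reversing the basis turns `(R, S)` into the bidiagonal pair `(S, R)`, and passing to the dual basis
turns it into the pair `(Sᵗ, Rᵗ)`. Hence each split basis yields four trace formulas: the basis, its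
reversal, its dual and the reversal of its dual
(`LeonardSystem.trace_of_isFirstSplitSequence`). The split bases of `Φ` and of `Φ^⇓` together give
all eight.

These traces are taken on `V`. They agree with the matrix traces because `𝒜` acts on `V` as the
full endomorphism algebra, by simplicity and a dimension count, and every algebra isomorphism
between endomorphism algebras is a conjugation (`trace_eq_trace_lsmul`).
-/

/-! ### Products along sequences and their reversals -/

section BidiagonalPairs

variable {K V : Type*} [Field K] [AddCommGroup V] [Module K V] {d : ℕ}

theorem Fin.Iio_succ_eq_insert (k : Fin d) :
    Finset.Iio k.succ = insert k.castSucc (Finset.Iio k.castSucc) := by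
  ext j
  simp only [Finset.mem_Iio, Finset.mem_insert, Fin.lt_def, Fin.ext_iff, Fin.val_succ,
    Fin.val_castSucc]
  omega

theorem Fin.Ioc_zero_succ_eq_insert (k : Fin d) :
    Finset.Ioc 0 k.succ = insert k.succ (Finset.Ioc 0 k.castSucc) := by
  ext j
  simp only [Finset.mem_Ioc, Finset.mem_insert, Fin.lt_def, Fin.le_def, Fin.ext_iff,
    Fin.val_succ, Fin.val_castSucc, Fin.val_zero]
  omega

theorem initialProd_zero (x : Fin d → K) : initialProd x 0 = 1 := by
  simp [initialProd]

theorem initialProd_succ (x : Fin d → K) (k : Fin d) :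
    initialProd x k.succ = x k * initialProd x k.castSucc := by
  have h : Finset.univ.filter (fun j : Fin d => j.castSucc < k.succ) =
      insert k (Finset.univ.filter fun j : Fin d => j.castSucc < k.castSucc) := by
    ext j
    simp only [Finset.mem_filter, Finset.mem_univ, true_and, Finset.mem_insert, Fin.lt_def,
      Fin.ext_iff, Fin.val_succ, Fin.val_castSucc]
    omega
  rw [initialProd, h, Finset.prod_insert (by simp), initialProd]

theorem initialProd_one (i : Fin (d + 1)) : initialProd (fun _ : Fin d => (1 : K)) i = 1 :=
  Finset.prod_const_one

theorem initialDiffProd_zero (t : Fin (d + 1) → K) : initialDiffProd t 0 = 1 := by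
  simp [initialDiffProd]

theorem initialDiffProd_succ (t : Fin (d + 1) → K) (k : Fin d) :
    initialDiffProd t k.succ = (t 0 - t k.succ) * initialDiffProd t k.castSucc := by
  rw [initialDiffProd, Fin.Ioc_zero_succ_eq_insert, Finset.prod_insert (by simp),
    initialDiffProd]

theorem initialProd_comp_rev (x : Fin d → K) (i : Fin (d + 1)) :
    initialProd (fun j => x (Fin.rev j)) i = finalProd x i :=
  rfl

theorem initialDiffProd_comp_rev (t : Fin (d + 1) → K) (i : Fin (d + 1)) :
    initialDiffProd (fun j => t (Fin.rev j)) i = finalDiffProd t i := by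
  simp [initialDiffProd, finalDiffProd]

theorem finalDiffProd_comp_rev (t : Fin (d + 1) → K) (i : Fin (d + 1)) :
    finalDiffProd (fun j => t (Fin.rev j)) i = initialDiffProd t i := by
  simp [initialDiffProd, finalDiffProd]

/-! ### Bidiagonal pairs -/

theorem aeval_dualMap (f : Module.End K V) (p : K[X]) :
    aeval (f.dualMap : Module.End K (Module.Dual K V)) p = (aeval f p).dualMap := by
  have hpow (n : ℕ) : (f.dualMap : Module.End K (Module.Dual K V)) ^ n = (f ^ n).dualMap := by
    induction n with
    | zero => rfl
    | succ n ih => rw [pow_succ, pow_succ', ih]; rfl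
  induction p using Polynomial.induction_on' with
  | add p q hp hq => rw [map_add, map_add, hp, hq]; ext; simp
  | monomial n c =>
    rw [aeval_monomial, aeval_monomial, hpow, ← Algebra.smul_def, ← Algebra.smul_def]
    ext g v
    simp

/-- The polynomial defining the first primitive idempotent of a reversed eigenvalue sequence is the
one defining the last primitive idempotent of the original sequence. -/
theorem lagrangeBasis_comp_rev (b : Fin (d + 1) → K) :
    Lagrange.basis Finset.univ (fun j => b (Fin.rev j)) 0
      = Lagrange.basis Finset.univ b (Fin.last d) := by
  have h := LeonardSystem.prod_erase_rev
    (fun j => Lagrange.basisDivisor (b (Fin.last d)) (b j)) 0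
  rw [Fin.rev_zero] at h
  simpa [Lagrange.basis] using h

/-- With respect to the basis `u_0, …, u_d`, the map `R` has diagonal entries `a_i` and otherwise
only raises the index by one, with coefficients `α`; the map `S` has diagonal entries `b_i` and
otherwise only lowers the index by one, with coefficients `β`. Both `α i` and `β i` belong to the
pair of neighbouring indices `i.castSucc`, `i.succ`. -/
structure IsBidiagonalPair (u : Module.Basis (Fin (d + 1)) K V) (R S : Module.End K V)
    (a : Fin (d + 1) → K) (α : Fin d → K) (b : Fin (d + 1) → K) (β : Fin d → K) : Prop where
  raise : ∀ i : Fin d, R (u i.castSucc) = a i.castSucc • u i.castSucc + α i • u i.succ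
  raise_last : R (u (Fin.last d)) = a (Fin.last d) • u (Fin.last d)
  lower : ∀ i : Fin d, S (u i.succ) = β i • u i.castSucc + b i.succ • u i.succ
  lower_zero : S (u 0) = b 0 • u 0

namespace IsBidiagonalPair

variable {u : Module.Basis (Fin (d + 1)) K V} {R S : Module.End K V}
  {a b : Fin (d + 1) → K} {α β : Fin d → K}

theorem reverse (h : IsBidiagonalPair u R S a α b β) :
    IsBidiagonalPair (u.reindex Fin.revPerm) S R (fun j => b (Fin.rev j))
      (fun j => β (Fin.rev j)) (fun j => a (Fin.rev j)) (fun j => α (Fin.rev j)) where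
  raise i := by
    simpa [Fin.rev_castSucc, Fin.rev_succ, add_comm] using h.lower (Fin.rev i)
  raise_last := by simpa using h.lower_zero
  lower i := by
    simpa [Fin.rev_castSucc, Fin.rev_succ, add_comm] using h.raise (Fin.rev i)
  lower_zero := by simpa using h.raise_last

theorem dual (h : IsBidiagonalPair u R S a α b β) :
    IsBidiagonalPair u.dualBasis S.dualMap R.dualMap b β a α where
  raise i := by
    refine u.ext fun j => ?_
    induction j using Fin.cases with
    | zero =>
      simp only [LinearMap.dualMap_apply, h.lower_zero, LinearMap.add_apply, LinearMap.smul_apply,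
        map_smul, u.dualBasis_apply_self, smul_eq_mul, (Fin.succ_ne_zero i).symm, if_false]
      grind
    | succ j =>
      simp only [LinearMap.dualMap_apply, h.lower, LinearMap.add_apply, LinearMap.smul_apply,
        map_add, map_smul, u.dualBasis_apply_self, smul_eq_mul]
      grind
  raise_last := by
    refine u.ext fun j => ?_
    induction j using Fin.cases with
    | zero =>
      simp only [LinearMap.dualMap_apply, h.lower_zero, LinearMap.smul_apply,
        map_smul, u.dualBasis_apply_self, smul_eq_mul]
      grind
    | succ j =>
      simp only [LinearMap.dualMap_apply, h.lower, LinearMap.smul_apply,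
        map_add, map_smul, u.dualBasis_apply_self, smul_eq_mul]
      grind
  lower i := by
    refine u.ext fun j => ?_
    induction j using Fin.lastCases with
    | last =>
      simp only [LinearMap.dualMap_apply, h.raise_last, LinearMap.add_apply, LinearMap.smul_apply,
        map_smul, u.dualBasis_apply_self, smul_eq_mul]
      grind
    | cast j =>
      simp only [LinearMap.dualMap_apply, h.raise, LinearMap.add_apply, LinearMap.smul_apply,
        map_add, map_smul, u.dualBasis_apply_self, smul_eq_mul]
      grind
  lower_zero := by
    refine u.ext fun j => ?_
    induction j using Fin.lastCases with
    | last =>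
      simp only [LinearMap.dualMap_apply, h.raise_last, LinearMap.smul_apply,
        map_smul, u.dualBasis_apply_self, smul_eq_mul]
      grind
    | cast j =>
      simp only [LinearMap.dualMap_apply, h.raise, LinearMap.smul_apply,
        map_add, map_smul, u.dualBasis_apply_self, smul_eq_mul]
      grind

theorem aeval_prod_apply_zero (h : IsBidiagonalPair u R S a α b β) (k : Fin (d + 1)) :
    aeval R (∏ j ∈ Finset.Iio k, (X - C (a j))) (u 0) = initialProd α k • u k := by
  induction k using Fin.induction with
  | zero =>
    have h0 : Finset.Iio (0 : Fin (d + 1)) = ∅ := by ext; simp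
    simp [initialProd_zero, h0]
  | succ k ih =>
    rw [Fin.Iio_succ_eq_insert, Finset.prod_insert (by simp), map_mul, Module.End.mul_apply, ih,
      map_smul, initialProd_succ]
    simp [h.raise, smul_smul, mul_comm]

/-- `S` is triangular on the basis, so `(S - b_0) ⋯ (S - b_k)` kills `u_k`. Allowing all multiples of
the polynomial is what makes the induction on `k` go through. -/
theorem aeval_eq_zero_of_prod_dvd (h : IsBidiagonalPair u R S a α b β) (k : Fin (d + 1)) :
    ∀ p : K[X], ∏ j ∈ Finset.Iic k, (X - C (b j)) ∣ p → aeval S p (u k) = 0 := by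
  induction k using Fin.induction with
  | zero =>
    rintro _ ⟨q, rfl⟩
    have h0 : Finset.Iic (0 : Fin (d + 1)) = {0} := by ext; simp
    rw [mul_comm, map_mul, Module.End.mul_apply, h0]
    simp [h.lower_zero]
  | succ k ih =>
    rintro _ ⟨q, rfl⟩
    have hk : Finset.Iic k.succ = insert k.succ (Finset.Iic k.castSucc) := by
      ext j
      simp only [Finset.mem_Iic, Finset.mem_insert, Fin.le_def, Fin.ext_iff, Fin.val_succ,
        Fin.val_castSucc]
      omega
    rw [hk, Finset.prod_insert (by simp), mul_assoc, mul_comm, map_mul, Module.End.mul_apply]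
    simp [h.lower, ih _ (dvd_mul_right _ q), -map_mul]

/-- The primitive idempotent of `S` for the eigenvalue `b_0` maps every basis vector into the line
spanned by `u_0`. -/
theorem aeval_basis_zero_apply (h : IsBidiagonalPair u R S a α b β) (hb : Function.Injective b)
    (k : Fin (d + 1)) :
    aeval S (Lagrange.basis Finset.univ b 0) (u k)
      = (initialProd β k / initialDiffProd b k) • u 0 := by
  induction k using Fin.induction with
  | zero =>
    rw [Module.End.aeval_apply_of_mem_apply_eq_smul h.lower_zero,
      Lagrange.eval_basis_self hb.injOn (Finset.mem_univ _), initialProd_zero,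
      initialDiffProd_zero, div_one]
  | succ k ih =>
    have hdvd : ∏ j ∈ Finset.Iic k.succ, (X - C (b j)) ∣
        Lagrange.basis Finset.univ b 0 * (X - C (b 0)) := by
      refine (Finset.prod_dvd_prod_of_subset _ _ _ (Finset.subset_univ _)).trans ?_
      rw [← Finset.mul_prod_erase _ _ (Finset.mem_univ 0), mul_comm]
      exact mul_dvd_mul_right (Finset.prod_dvd_prod_of_dvd _ _ fun j _ => dvd_mul_left _ _) _
    have hne : b 0 - b k.succ ≠ 0 := sub_ne_zero.2 (hb.ne (Fin.succ_ne_zero k).symm)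
    have h0 := h.aeval_eq_zero_of_prod_dvd _ _ hdvd
    rw [map_mul, Module.End.mul_apply] at h0
    simp only [map_sub, aeval_X, aeval_C, LinearMap.sub_apply, h.lower, map_add, map_smul, ih,
      Module.algebraMap_end_apply] at h0
    -- `P S = b_0 P` on `u_{k+1}`, expanded by the formula for `S u_{k+1}`
    have h1 : (b 0 - b k.succ) • aeval S (Lagrange.basis Finset.univ b 0) (u k.succ)
        = β k • (initialProd β k.castSucc / initialDiffProd b k.castSucc) • u 0 := by
      rw [sub_smul, ← sub_eq_zero, ← neg_eq_zero, ← h0]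
      abel
    rw [← inv_smul_smul₀ hne (aeval S _ _), h1, smul_smul, smul_smul, initialProd_succ,
      initialDiffProd_succ]
    congr 1
    field_simp

theorem trace_aeval_prod_mul_aeval_basis (h : IsBidiagonalPair u R S a α b β)
    (hb : Function.Injective b) (k : Fin (d + 1)) :
    LinearMap.trace K V (aeval R (∏ j ∈ Finset.Iio k, (X - C (a j))) *
        aeval S (Lagrange.basis Finset.univ b 0))
      = initialProd α k * initialProd β k / initialDiffProd b k := by
  rw [LinearMap.trace_eq_matrix_trace K u, Matrix.trace]
  simp_rw [Matrix.diag_apply, LinearMap.toMatrix_apply, Module.End.mul_apply,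
    h.aeval_basis_zero_apply hb, map_smul, h.aeval_prod_apply_zero]
  rw [Finset.sum_eq_single k]
  · simp; ring
  · intro j _ hj
    simp [hj.symm]
  · simp

end IsBidiagonalPair

end BidiagonalPairs

/-! ### The trace of an algebra isomorphic to a matrix algebra -/

/-- On an algebra isomorphic to `Mat_{n+1}(K)`, the matrix trace is the trace of the action on any
module of dimension `n + 1`. -/
theorem trace_eq_trace_lsmul {K : Type*} [Field K] {n : ℕ} {𝒜 : Type*} [Ring 𝒜] [Algebra K 𝒜]
    (ι : 𝒜 ≃ₐ[K] Matrix (Fin (n + 1)) (Fin (n + 1)) K)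
    {V : Type*} [AddCommGroup V] [Module K V] [Module 𝒜 V] [IsScalarTower K 𝒜 V]
    (u : Module.Basis (Fin (n + 1)) K V) (x : 𝒜) :
    (ι x).trace = LinearMap.trace K V (Algebra.lsmul K K V x) := by
  have : Nontrivial (Module.End K V) := (LinearMap.toMatrixAlgEquiv u).toEquiv.nontrivial
  have : IsSimpleRing 𝒜 := (IsSimpleRing.of_ringEquiv ι.symm.toRingEquiv inferInstance)
  have : FiniteDimensional K 𝒜 := Module.Finite.equiv ι.symm.toLinearEquiv
  have : FiniteDimensional K V := Module.Finite.of_basis u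
  -- The action is injective as `𝒜` is simple, hence bijective as the dimensions agree.
  have hinj : Function.Injective (Algebra.lsmul K K V : 𝒜 →ₐ[K] Module.End K V) :=
    (Algebra.lsmul K K V : 𝒜 →ₐ[K] Module.End K V).toRingHom.injective
  have hdim : Module.finrank K 𝒜 = Module.finrank K (Module.End K V) := by
    rw [ι.toLinearEquiv.finrank_eq, (LinearMap.toMatrixAlgEquiv u).toLinearEquiv.finrank_eq]
  let e : 𝒜 ≃ₐ[K] Module.End K V := AlgEquiv.ofBijective (Algebra.lsmul K K V)
    ⟨hinj, (LinearMap.injective_iff_surjective_of_finrank_eq_finrank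
      (f := (Algebra.lsmul K K V : 𝒜 →ₐ[K] Module.End K V).toLinearMap) hdim).1 hinj⟩
  obtain ⟨T, hT⟩ :=
    ((Matrix.toLinAlgEquiv'.symm.trans ι.symm).trans e).eq_linearEquivConjAlgEquiv
  have hx : e x = T.conj (Matrix.toLin' (ι x)) := by
    have := congr($hT (Matrix.toLin' (ι x)))
    simp only [AlgEquiv.trans_apply] at this
    change e (ι.symm (Matrix.toLinAlgEquiv'.symm (Matrix.toLinAlgEquiv' (ι x)))) = _ at this
    rwa [AlgEquiv.symm_apply_apply, AlgEquiv.symm_apply_apply] at this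
  change _ = LinearMap.trace K V (e x)
  rw [hx, LinearMap.trace_conj', Matrix.trace_toLin'_eq]


/-! ### Traces attached to a Leonard system -/

namespace LeonardSystem

variable {K V 𝒜 : Type*} {d : ℕ} [Field K] [Ring 𝒜] [Algebra K 𝒜]
  [AddCommGroup V] [Module K V] [Module 𝒜 V] [IsScalarTower K 𝒜 V]

theorem IsFirstSplitSequence.exists_isBidiagonalPair {Φ : LeonardSystem K 𝒜 d} {φ : Fin d → K}
    (h : Φ.IsFirstSplitSequence V φ) :
    ∃ u : Module.Basis (Fin (d + 1)) K V,
      IsBidiagonalPair u (Algebra.lsmul K K V Φ.A) (Algebra.lsmul K K V Φ.Astar)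
        Φ.θ (fun _ => 1) Φ.θstar φ := by
  obtain ⟨-, u, h1, h2, h3, h4⟩ := h
  exact ⟨u, by simpa using h1, h2, h3, h4⟩

/-- The four trace formulas that come from a single split basis. -/
theorem trace_of_isFirstSplitSequence
    (ι : 𝒜 ≃ₐ[K] Matrix (Fin (d + 1)) (Fin (d + 1)) K) (Φ : LeonardSystem K 𝒜 d)
    {φ : Fin d → K} (hφ : Φ.IsFirstSplitSequence V φ) (i : Fin (d + 1)) :
    (ι (aeval Φ.A (Φ.τ i) * Φ.Estar 0)).trace
        = initialProd φ i / initialDiffProd Φ.θstar i ∧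
    (ι (aeval Φ.A (Φ.η i) * Φ.Estar (Fin.last d))).trace
        = finalProd φ i / finalDiffProd Φ.θstar i ∧
    (ι (aeval Φ.Astar (Φ.τstar i) * Φ.E 0)).trace
        = initialProd φ i / initialDiffProd Φ.θ i ∧
    (ι (aeval Φ.Astar (Φ.ηstar i) * Φ.E (Fin.last d))).trace
        = finalProd φ i / finalDiffProd Φ.θ i := by
  obtain ⟨u, hu⟩ := hφ.exists_isBidiagonalPair
  have : FiniteDimensional K V := Module.Finite.of_basis u
  have hE (k) : Φ.E k = aeval Φ.A (Lagrange.basis Finset.univ Φ.θ k) := Φ.E_eq k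
  have hEstar (k) : Φ.Estar k = aeval Φ.Astar (Lagrange.basis Finset.univ Φ.θstar k) :=
    Φ.Estar_eq k
  have hθ : Function.Injective fun j => Φ.θ (Fin.rev j) := Φ.θ_injective.comp Fin.rev_injective
  have hθstar : Function.Injective fun j => Φ.θstar (Fin.rev j) :=
    Φ.θstar_injective.comp Fin.rev_injective
  have htrace (x y : 𝒜) (p q : K[X]) : (ι (aeval x p * aeval y q)).trace =
      LinearMap.trace K V (aeval (Algebra.lsmul K K V x) p * aeval (Algebra.lsmul K K V y) q) := by
    rw [trace_eq_trace_lsmul ι u, map_mul, aeval_algHom_apply, aeval_algHom_apply]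
  have hdual (f g : Module.End K V) (p q : K[X]) :
      LinearMap.trace K (Module.Dual K V) (aeval f.dualMap p * aeval g.dualMap q) =
        LinearMap.trace K V (aeval f p * aeval g q) := by
    rw [LinearMap.trace_mul_comm, aeval_dualMap, aeval_dualMap]
    exact LinearMap.trace_transpose' (aeval f p * aeval g q)
  rw [hE, hE, hEstar, hEstar, htrace, htrace, htrace, htrace]
  refine ⟨?_, ?_, ?_, ?_⟩
  · have := hu.trace_aeval_prod_mul_aeval_basis Φ.θstar_injective i
    rwa [initialProd_one, one_mul] at this
  · have := hu.dual.reverse.trace_aeval_prod_mul_aeval_basis hθstar i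
    rwa [hdual, lagrangeBasis_comp_rev, initialProd_one, one_mul, initialProd_comp_rev,
      initialDiffProd_comp_rev] at this
  · have := hu.dual.trace_aeval_prod_mul_aeval_basis Φ.θ_injective i
    rwa [hdual, initialProd_one, mul_one] at this
  · have := hu.reverse.trace_aeval_prod_mul_aeval_basis hθ i
    rwa [lagrangeBasis_comp_rev, initialProd_one, mul_one, initialProd_comp_rev,
      initialDiffProd_comp_rev] at this

theorem ddown_η (Φ : LeonardSystem K 𝒜 d) (i : Fin (d + 1)) : Φ.ddown.η i = Φ.τ i := by
  simp [η, τ, ddown]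

end LeonardSystem

theorem proposition4p4 {K : Type*} [Field K] {d : ℕ} {𝒜 : Type*} [Ring 𝒜] [Algebra K 𝒜]
    (ι : 𝒜 ≃ₐ[K] Matrix (Fin (d + 1)) (Fin (d + 1)) K)
    {V : Type*} [AddCommGroup V] [Module K V] [Module 𝒜 V] [IsScalarTower K 𝒜 V]
    [IsSimpleModule 𝒜 V]
    (Φ : LeonardSystem K 𝒜 d) (φ ϕ : Fin d → K)
    (hφ : Φ.IsFirstSplitSequence V φ) (hϕ : Φ.IsSecondSplitSequence V ϕ)
    (i : Fin (d + 1)) :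
    (ι (Polynomial.aeval Φ.A (Φ.τ i) * Φ.Estar 0)).trace
        = initialProd φ i / initialDiffProd Φ.θstar i ∧
    (ι (Polynomial.aeval Φ.A (Φ.τ i) * Φ.Estar (Fin.last d))).trace
        = finalProd ϕ i / finalDiffProd Φ.θstar i ∧
    (ι (Polynomial.aeval Φ.A (Φ.η i) * Φ.Estar 0)).trace
        = initialProd ϕ i / initialDiffProd Φ.θstar i ∧
    (ι (Polynomial.aeval Φ.A (Φ.η i) * Φ.Estar (Fin.last d))).trace
        = finalProd φ i / finalDiffProd Φ.θstar i ∧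
    (ι (Polynomial.aeval Φ.Astar (Φ.τstar i) * Φ.E 0)).trace
        = initialProd φ i / initialDiffProd Φ.θ i ∧
    (ι (Polynomial.aeval Φ.Astar (Φ.τstar i) * Φ.E (Fin.last d))).trace
        = initialProd ϕ i / finalDiffProd Φ.θ i ∧
    (ι (Polynomial.aeval Φ.Astar (Φ.ηstar i) * Φ.E 0)).trace
        = finalProd ϕ i / initialDiffProd Φ.θ i ∧
    (ι (Polynomial.aeval Φ.Astar (Φ.ηstar i) * Φ.E (Fin.last d))).trace
        = finalProd φ i / finalDiffProd Φ.θ i := by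
  obtain ⟨h1, h4, h5, h8⟩ := Φ.trace_of_isFirstSplitSequence ι hφ i
  obtain ⟨h3, h2, h6, h7⟩ := Φ.ddown.trace_of_isFirstSplitSequence ι hϕ i
  rw [Φ.ddown_η] at h2
  change _ = _ / initialDiffProd (fun j => Φ.θ (Fin.rev j)) i at h6
  change _ = _ / finalDiffProd (fun j => Φ.θ (Fin.rev j)) i at h7
  rw [initialDiffProd_comp_rev] at h6
  rw [finalDiffProd_comp_rev] at h7
  simp only [LeonardSystem.ddown, Fin.rev_zero, Fin.rev_last] at h2 h3 h6 h7
  exact ⟨h1, h2, h3, h4, h5, h6, h7, h8⟩
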